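/- Fix $\omega\in(0,\infty)$. Let $\sigma_1=\begin{bmatrix}0&1\\1&0\end{bmatrix}$, $\sigma_3=\begin{bmatrix}1&0\\0&-1\end{bmatrix}$, and for $x,\xi\in\mathbb R$ set $$\Psi_{1,\omega}(x,\xi)=\frac1{\sqrt{2\pi}}\frac{(\xi+i\sqrt\omega\tanh(\sqrt\omega x))^2}{(|\xi|-i\sqrt\omega)^2}e^{ix\xi},\qquad \Psi_{2,\omega}(x,\xi)=\frac1{\sqrt{2\pi}}\frac{(\sqrt\omega\,\mathrm{sech}(\sqrt\omega x))^2}{(|\xi|-i\sqrt\omega)^2}e^{ix\xi},$$ $$\Psi_{+,\omega}=\begin{bmatrix}\Psi_{1,\omega}\\ \Psi_{2,\omega}\end{bmatrix},\qquad \Psi_{-,\omega}=\sigma_1\Psi_{+,\omega}=\begin{bmatrix}\Psi_{2,\omega}\\ \Psi_{1,\omega}\end{bmatrix}.$$ For $U,V\colon\mathbb R\to\mathbb C^2$ write $\langle U,V\rangle=\int_{\mathbb R}(u_1\bar v_1+u_2\bar v_2)\,dx$. Then, in the sense of (tempered) distributions in $(\xi,\eta)\in\mathbb R^2$, $$\langle\Psi_{+,\omega}(\cdot,\xi),\sigma_3\Psi_{+,\omega}(\cdot,\eta)\rangle=\delta_0(\xi-\eta),\qquad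 \langle\Psi_{-,\omega}(\cdot,\xi),\sigma_3\Psi_{-,\omega}(\cdot,\eta)\rangle=-\delta_0(\xi-\eta),$$ $$\langle\Psi_{+,\omega}(\cdot,\xi),\sigma_3\Psi_{-,\omega}(\cdot,\eta)\rangle=0,\qquad \langle\Psi_{-,\omega}(\cdot,\xi),\sigma_3\Psi_{+,\omega}(\cdot,\eta)\rangle=0.$$ Here $\langle U(\cdot,\xi),V(\cdot,\eta)\rangle=T$ in the sense of distributions means that for every Schwartz function $\varphi\in\mathcal S(\mathbb R^2)$ $$\int_{\mathbb R}\Big(\iint_{\mathbb R^2}\varphi(\xi,\eta)\big(U_1(x,\xi)\overline{V_1(x,\eta)}+U_2(x,\xi)\overline{V_2(x,\eta)}\big)\,d\xi\,d\eta\Big)dx=T(\varphi),$$ where the inner integral (for every $x$) and the outer integral converge absolutely, and $\delta_0(\xi-\eta)$ is the distribution $\varphi\mapsto\int_{\mathbb R}\varphi(\xi,\xi)\,d\xi$. -/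

import Mathlib

open scoped SchwartzMap Matrix

noncomputable section

/-- The Pauli matrix `σ₁`. -/
def pauli1 : Matrix (Fin 2) (Fin 2) ℂ := !![0, 1; 1, 0]

/-- The Pauli matrix `σ₃`. -/
def pauli3 : Matrix (Fin 2) (Fin 2) ℂ := !![1, 0; 0, -1]

/-- The real hyperbolic secant. -/
def sech (x : ℝ) : ℝ := 1 / Real.cosh x

/-- First component `Ψ_{1,ω}(x, ξ)` of the distorted Fourier basis. -/
def psi1 (ω x ξ : ℝ) : ℂ :=
  1 / (√(2 * Real.pi) : ℂ) *
    (((ξ : ℂ) + Complex.I * √ω * Real.tanh (√ω * x)) ^ 2 / ((|ξ| : ℝ) - Complex.I * √ω) ^ 2) *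
    Complex.exp (Complex.I * x * ξ)

/-- Second component `Ψ_{2,ω}(x, ξ)` of the distorted Fourier basis. -/
def psi2 (ω x ξ : ℝ) : ℂ :=
  1 / (√(2 * Real.pi) : ℂ) *
    (((√ω : ℂ) * sech (√ω * x)) ^ 2 / ((|ξ| : ℝ) - Complex.I * √ω) ^ 2) *
    Complex.exp (Complex.I * x * ξ)

/-- The basis function `Ψ_{+,ω}(x, ξ) ∈ ℂ²`. -/
def psiPlus (ω x ξ : ℝ) : Fin 2 → ℂ := ![psi1 ω x ξ, psi2 ω x ξ]

/-- The basis function `Ψ_{-,ω}(x, ξ) = σ₁ Ψ_{+,ω}(x, ξ) ∈ ℂ²`. -/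
def psiMinus (ω x ξ : ℝ) : Fin 2 → ℂ := pauli1 *ᵥ psiPlus ω x ξ

/-- The integrand `u₁ v̄₁ + u₂ v̄₂` of the inner product `⟨U, V⟩ = ∫ (u₁ v̄₁ + u₂ v̄₂) dx`
of two functions `ℝ → ℂ²`. -/
def innerDensity (u v : Fin 2 → ℂ) : ℂ := u 0 * star (v 0) + u 1 * star (v 1)

/-- For families `U(·, ξ)`, `V(·, η)` of functions `ℝ → ℂ²` and a tempered distribution `T`
in `(ξ, η) ∈ ℝ²`, the identity
`⟨U(·, ξ), V(·, η)⟩ = ∫ (U₁(x, ξ) V̄₁(x, η) + U₂(x, ξ) V̄₂(x, η)) dx = T(ξ, η)`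
in the sense of distributions: the oscillatory integral in `x` is taken after testing the
integrand against an arbitrary Schwartz function `φ(ξ, η)`. The integrals that occur are required
to converge absolutely. -/
def PairingEqDistribution (U V : ℝ → ℝ → Fin 2 → ℂ) (T : 𝓢'(ℝ × ℝ, ℂ)) : Prop :=
  ∀ φ : 𝓢(ℝ × ℝ, ℂ),
    (∀ x : ℝ, MeasureTheory.Integrable
      (fun p : ℝ × ℝ => φ p * innerDensity (U x p.1) (V x p.2))) ∧
    MeasureTheory.Integrable
      (fun x : ℝ => ∫ p : ℝ × ℝ, φ p * innerDensity (U x p.1) (V x p.2)) ∧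
    ∫ x : ℝ, ∫ p : ℝ × ℝ, φ p * innerDensity (U x p.1) (V x p.2) = T φ

/-- Restriction `φ ↦ (ξ ↦ φ(ξ, ξ))` of Schwartz functions on `ℝ²` to the diagonal. -/
def diagRestrict : 𝓢(ℝ × ℝ, ℂ) →L[ℂ] 𝓢(ℝ, ℂ) :=
  SchwartzMap.compCLMOfAntilipschitz ℂ (K := 1) (g := fun ξ : ℝ => (ξ, ξ))
    ((ContinuousLinearMap.id ℝ ℝ).prod (ContinuousLinearMap.id ℝ ℝ)).hasTemperateGrowth
    (fun x y => by simp [Prod.edist_eq])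

/-- The tempered distribution `δ₀(ξ - η)` on `ℝ²`, i.e. `φ ↦ ∫ φ(ξ, ξ) dξ`. -/
def deltaDiag : 𝓢'(ℝ × ℝ, ℂ) :=
  ContinuousLinearMap.toPointwiseConvergenceCLM ℂ (RingHom.id ℂ) 𝓢(ℝ × ℝ, ℂ) ℂ
    ((SchwartzMap.integralCLM ℂ (MeasureTheory.volume : MeasureTheory.Measure ℝ)).comp
      diagRestrict)

theorem deltaDiag_apply (φ : 𝓢(ℝ × ℝ, ℂ)) : deltaDiag φ = ∫ ξ : ℝ, φ (ξ, ξ) := rfl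

end

open MeasureTheory Filter Topology
open scoped SchwartzMap Matrix

noncomputable section

/-! Write a = √ω, τ = tanh(a x), d = ξ - η and P = ξη + a². Each density is 1/(2π) times a
polynomial in ξ, η, τ times p(ξ) q(η) e^{ixd}, where p = (|ξ| - ia)⁻² and q is its conjugate. The
key is that, since τ' = a(1 - τ²), the τ-dependence is an exact x-derivative: ((ξ + iaτ)(η - iaτ))²
- a⁴(1 - τ²)² = P² + e^{-ixd} ∂ₓ[(-2aPτ + ia²dτ²) e^{ixd}], a²(1 - τ²)((ξ + iaτ)² - (η - iaτ)²) =
e^{-ixd} ∂ₓ[-ia²(ξ + η)(1 - τ²) e^{ixd}].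

After testing against φ the total derivatives integrate to zero (`integral_tanhPowDeriv`). The term
P² gives, by Fourier inversion (`integral_oscIntegral`), 2π times the integral over the diagonal,
where P² p q = 1.

The analytic difficulty is absolute convergence in x, because |ξ| makes the weights nonsmooth at 0.
A continuous weight with bounded derivative off 0 permits one integration by parts. Doing this once
in ξ and once in η yields decay (1 + x²)⁻¹, which is integrable
(`exists_norm_oscIntegral_le_inv_one_add_sq`). -/

/-- A bounded measurable function on the line. -/
def IsBoundedWeight (p : ℝ → ℂ) : Prop := Measurable p ∧ ∃ C, ∀ t, ‖p t‖ ≤ C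

/-- A bounded continuous function on the line which is differentiable away from the origin and
has a bounded derivative. -/
structure IsKinkWeight (p : ℝ → ℂ) : Prop where
  continuous : Continuous p
  bounded : ∃ C, ∀ t, ‖p t‖ ≤ C
  differentiableAt : ∀ t ≠ 0, DifferentiableAt ℝ p t
  deriv_bounded : ∃ C, ∀ t, ‖deriv p t‖ ≤ C

theorem IsKinkWeight.isBoundedWeight {p : ℝ → ℂ} (hp : IsKinkWeight p) : IsBoundedWeight p :=
  ⟨hp.continuous.measurable, hp.bounded⟩

theorem IsKinkWeight.isBoundedWeight_deriv {p : ℝ → ℂ} (hp : IsKinkWeight p) :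
    IsBoundedWeight (deriv p) :=
  ⟨measurable_deriv p, hp.deriv_bounded⟩

/-! ### Integration by parts against a weight with a kink -/

/-- The integral over the line of a derivative vanishes, for functions with one kink. -/
theorem integral_eq_zero_of_hasDerivAt_off_zero {f f' : ℝ → ℂ} (hf : Continuous f)
    (hderiv : ∀ t ≠ 0, HasDerivAt f (f' t) t) (hint : Integrable f')
    (hbot : Tendsto f atBot (𝓝 0)) (htop : Tendsto f atTop (𝓝 0)) : ∫ t, f' t = 0 := by
  rw [← setIntegral_univ, ← Set.Iic_union_Ioi (a := 0),
    setIntegral_union (Set.Iic_disjoint_Ioi le_rfl) measurableSet_Ioi hint.integrableOn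
      hint.integrableOn,
    integral_Iic_of_hasDerivAt_of_tendsto hf.continuousWithinAt
      (fun t ht => hderiv t (ne_of_lt ht)) hint.integrableOn hbot,
    integral_Ioi_of_hasDerivAt_of_tendsto hf.continuousWithinAt
      (fun t ht => hderiv t (ne_of_gt ht)) hint.integrableOn htop]
  simp

theorem norm_exp_I_mul_mul (x t : ℝ) : ‖Complex.exp (Complex.I * x * t)‖ = 1 := by
  rw [show Complex.I * x * t = ((x * t : ℝ) : ℂ) * Complex.I by push_cast; ring,
    Complex.norm_exp_ofReal_mul_I]

theorem IsBoundedWeight.mul_exp {p : ℝ → ℂ} (hp : IsBoundedWeight p) (x : ℝ) :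
    IsBoundedWeight (fun t => p t * Complex.exp (Complex.I * x * t)) := by
  obtain ⟨hm, C, hC⟩ := hp
  refine ⟨by fun_prop, C, fun t => ?_⟩
  rw [norm_mul, norm_exp_I_mul_mul, mul_one]
  exact hC t

theorem IsBoundedWeight.integrable_schwartz_mul {p : ℝ → ℂ} (hp : IsBoundedWeight p)
    (f : 𝓢(ℝ, ℂ)) : Integrable (fun t => f t * p t) := by
  obtain ⟨hm, C, hC⟩ := hp
  exact f.integrable.mul_bdd (c := C) hm.aestronglyMeasurable (Eventually.of_forall hC)

/-- Continuity of `p` makes the boundary terms from the two half-lines cancel at the kink, so no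
point contribution appears. -/
theorem integral_schwartz_mul_kink_mul_exp {p : ℝ → ℂ} (hp : IsKinkWeight p) (f : 𝓢(ℝ, ℂ))
    (x : ℝ) :
    Complex.I * x * ∫ t, f t * (p t * Complex.exp (Complex.I * x * t)) =
      -(∫ t, deriv f t * (p t * Complex.exp (Complex.I * x * t))) -
        ∫ t, f t * (deriv p t * Complex.exp (Complex.I * x * t)) := by
  have h0 := (hp.isBoundedWeight.mul_exp x).integrable_schwartz_mul f
  have h1 := (hp.isBoundedWeight.mul_exp x).integrable_schwartz_mul (SchwartzMap.derivCLM ℂ ℂ f)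
  have h2 := (hp.isBoundedWeight_deriv.mul_exp x).integrable_schwartz_mul f
  simp only [SchwartzMap.derivCLM_apply] at h1
  have hlim : Tendsto (fun t => f t * (p t * Complex.exp (Complex.I * x * t)))
      (cocompact ℝ) (𝓝 0) := by
    obtain ⟨C, hC⟩ := (hp.isBoundedWeight.mul_exp x).2
    refine (zero_at_infty f).zero_mul_isBoundedUnder_le ?_
    exact ⟨C, Filter.eventually_map.2 (Eventually.of_forall hC)⟩
  have key := integral_eq_zero_of_hasDerivAt_off_zero
    (f := fun t => f t * (p t * Complex.exp (Complex.I * x * t)))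
    (f' := fun t => deriv f t * (p t * Complex.exp (Complex.I * x * t)) +
      f t * (deriv p t * Complex.exp (Complex.I * x * t)) +
      Complex.I * x * (f t * (p t * Complex.exp (Complex.I * x * t))))
    (by have := hp.continuous; have := f.continuous; fun_prop)
    (fun t ht => by
      have hE : HasDerivAt (fun t : ℝ => Complex.exp (Complex.I * x * t))
          (Complex.exp (Complex.I * x * t) * (Complex.I * x * 1)) t :=
        ((Complex.ofRealCLM.hasDerivAt (x := t)).const_mul (Complex.I * x)).cexp
      have := (f.differentiableAt (x := t)).hasDerivAt.mul
        ((hp.differentiableAt t ht).hasDerivAt.mul hE)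
      convert! this using 1
      simp only [Pi.mul_apply]
      ring)
    ((h1.add h2).add (h0.const_mul _))
    (hlim.mono_left (by rw [cocompact_eq_atBot_atTop]; exact le_sup_left))
    (hlim.mono_left (by rw [cocompact_eq_atBot_atTop]; exact le_sup_right))
  rw [integral_add (by exact h1.add h2) (h0.const_mul _), integral_add h1 h2,
    integral_const_mul] at key
  linear_combination key

/-! ### Oscillatory integrals in two variables and their decay -/

/-- The restriction `t ↦ φ (t, s)` of a Schwartz function on the plane to a horizontal line. -/
def horizontalSlice (φ : 𝓢(ℝ × ℝ, ℂ)) (s : ℝ) : 𝓢(ℝ, ℂ) :=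
  SchwartzMap.compCLMOfAntilipschitz ℂ (K := 1) (g := fun t : ℝ => (t, s))
    (by
      have h := ((ContinuousLinearMap.inl ℝ ℝ ℝ).hasTemperateGrowth).add
        (Function.HasTemperateGrowth.const (E := ℝ) ((0, s) : ℝ × ℝ))
      convert! h using 1
      ext t <;> simp)
    (fun x y => by simp [Prod.edist_eq]) φ

theorem horizontalSlice_apply (φ : 𝓢(ℝ × ℝ, ℂ)) (s t : ℝ) : horizontalSlice φ s t = φ (t, s) :=
  rfl

/-- The partial derivative of a Schwartz function in the first variable. -/
def partialFst (φ : 𝓢(ℝ × ℝ, ℂ)) : 𝓢(ℝ × ℝ, ℂ) := LineDeriv.lineDerivOp ((1, 0) : ℝ × ℝ) φ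

theorem deriv_horizontalSlice (φ : 𝓢(ℝ × ℝ, ℂ)) (s t : ℝ) :
    deriv (horizontalSlice φ s) t = partialFst φ (t, s) := by
  rw [partialFst, SchwartzMap.lineDerivOp_apply_eq_fderiv]
  have h1 : HasDerivAt (fun t : ℝ => (t, s)) ((1, 0) : ℝ × ℝ) t :=
    (hasDerivAt_id t).prodMk (hasDerivAt_const t s)
  exact ((φ.differentiableAt (x := (t, s))).hasFDerivAt.comp_hasDerivAt t h1).deriv

/-- Interchange of the two variables of a Schwartz function. -/
def swapSchwartz (φ : 𝓢(ℝ × ℝ, ℂ)) : 𝓢(ℝ × ℝ, ℂ) :=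
  SchwartzMap.compCLMOfContinuousLinearEquiv ℂ (ContinuousLinearEquiv.prodComm ℝ ℝ ℝ) φ

theorem swapSchwartz_apply (φ : 𝓢(ℝ × ℝ, ℂ)) (z : ℝ × ℝ) : swapSchwartz φ z = φ z.swap := rfl

/-- The kernel `p(ξ) q(η) e^{i x (ξ - η)}`. -/
def oscKernel (p q : ℝ → ℂ) (x : ℝ) (z : ℝ × ℝ) : ℂ :=
  p z.1 * Complex.exp (Complex.I * x * z.1) * (q z.2 * Complex.exp (Complex.I * (-x : ℝ) * z.2))

theorem integrable_mul_oscKernel {p q : ℝ → ℂ} (hp : IsBoundedWeight p) (hq : IsBoundedWeight q)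
    (x : ℝ) (φ : 𝓢(ℝ × ℝ, ℂ)) : Integrable (fun z => φ z * oscKernel p q x z) := by
  obtain ⟨hpm, C, hC⟩ := hp.mul_exp x
  obtain ⟨hqm, D, hD⟩ := hq.mul_exp (-x)
  refine φ.integrable.mul_bdd (c := C * D) ?_ (Eventually.of_forall fun z => ?_)
  · exact ((hpm.comp measurable_fst).mul (hqm.comp measurable_snd)).aestronglyMeasurable
  · rw [oscKernel, norm_mul]
    exact mul_le_mul (hC _) (hD _) (norm_nonneg _) ((norm_nonneg _).trans (hC z.1))

/-- The oscillatory integral `∬ φ(ξ, η) p(ξ) q(η) e^{i x (ξ - η)} dξ dη`. -/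
def oscIntegral (p q : ℝ → ℂ) (φ : 𝓢(ℝ × ℝ, ℂ)) (x : ℝ) : ℂ := ∫ z, φ z * oscKernel p q x z

theorem exists_norm_oscIntegral_le {p q : ℝ → ℂ} (hp : IsBoundedWeight p)
    (hq : IsBoundedWeight q) (φ : 𝓢(ℝ × ℝ, ℂ)) : ∃ C, ∀ x, ‖oscIntegral p q φ x‖ ≤ C := by
  obtain ⟨hpm, C, hC⟩ := hp
  obtain ⟨hqm, D, hD⟩ := hq
  refine ⟨∫ z, ‖φ z‖ * (C * D), fun x => ?_⟩
  refine norm_integral_le_of_norm_le (φ.integrable.norm.mul_const _)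
    (Eventually.of_forall fun z => ?_)
  rw [norm_mul, oscKernel, norm_mul, norm_mul, norm_mul, norm_exp_I_mul_mul, norm_exp_I_mul_mul,
    mul_one, mul_one]
  gcongr
  · exact (norm_nonneg _).trans (hC 0)
  · exact hC _
  · exact hD _

/-- Reduces integration by parts in η to integration by parts in ξ. -/
theorem oscIntegral_swap (p q : ℝ → ℂ) (φ : 𝓢(ℝ × ℝ, ℂ)) (x : ℝ) :
    oscIntegral p q φ x = oscIntegral q p (swapSchwartz φ) (-x) := by
  rw [oscIntegral, oscIntegral, Measure.volume_eq_prod, ← integral_prod_swap]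
  refine integral_congr_ae (Eventually.of_forall fun z => ?_)
  simp [swapSchwartz_apply, oscKernel, mul_comm, mul_left_comm]

theorem oscIntegral_eq_iterated {p q : ℝ → ℂ} (hp : IsBoundedWeight p) (hq : IsBoundedWeight q)
    (φ : 𝓢(ℝ × ℝ, ℂ)) (x : ℝ) :
    oscIntegral p q φ x = ∫ s, (∫ t, horizontalSlice φ s t *
      (p t * Complex.exp (Complex.I * x * t))) *
      (q s * Complex.exp (Complex.I * (-x : ℝ) * s)) := by
  rw [oscIntegral, Measure.volume_eq_prod, integral_prod_symm _ (by
    rw [← Measure.volume_eq_prod]; exact integrable_mul_oscKernel hp hq x φ)]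
  refine integral_congr_ae (Eventually.of_forall fun s => ?_)
  simp only
  rw [← integral_mul_const]
  refine integral_congr_ae (Eventually.of_forall fun t => ?_)
  simp only [oscKernel, horizontalSlice_apply]
  ring

theorem integrable_iterated {p q : ℝ → ℂ} (hp : IsBoundedWeight p) (hq : IsBoundedWeight q)
    (φ : 𝓢(ℝ × ℝ, ℂ)) (x : ℝ) :
    Integrable (fun s => (∫ t, horizontalSlice φ s t *
      (p t * Complex.exp (Complex.I * x * t))) *
      (q s * Complex.exp (Complex.I * (-x : ℝ) * s))) := by
  have h := integrable_mul_oscKernel hp hq x φ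
  rw [Measure.volume_eq_prod] at h
  refine h.integral_prod_right.congr (Eventually.of_forall fun s => ?_)
  simp only
  rw [← integral_mul_const]
  refine integral_congr_ae (Eventually.of_forall fun t => ?_)
  simp only [oscKernel, horizontalSlice_apply]
  ring

/-- Fubini and the one-dimensional integration by parts on each horizontal slice. No regularity of
`q` enters. -/
theorem mul_oscIntegral_fst {p q : ℝ → ℂ} (hp : IsKinkWeight p) (hq : IsBoundedWeight q)
    (φ : 𝓢(ℝ × ℝ, ℂ)) (x : ℝ) :
    Complex.I * x * oscIntegral p q φ x =
      -oscIntegral p q (partialFst φ) x - oscIntegral (deriv p) q φ x := by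
  rw [oscIntegral_eq_iterated hp.isBoundedWeight hq, oscIntegral_eq_iterated hp.isBoundedWeight hq,
    oscIntegral_eq_iterated hp.isBoundedWeight_deriv hq, ← integral_const_mul, ← integral_neg,
    ← integral_sub (integrable_iterated hp.isBoundedWeight hq _ x).fun_neg
      (integrable_iterated hp.isBoundedWeight_deriv hq _ x)]
  refine integral_congr_ae (Eventually.of_forall fun s => ?_)
  have h := integral_schwartz_mul_kink_mul_exp hp (horizontalSlice φ s) x
  simp only [deriv_horizontalSlice] at h
  simp only [horizontalSlice_apply] at h ⊢
  linear_combination (q s * Complex.exp (Complex.I * (-x : ℝ) * s)) * h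

theorem exists_norm_mul_oscIntegral_snd_le {p q : ℝ → ℂ} (hp : IsBoundedWeight p)
    (hq : IsKinkWeight q) (φ : 𝓢(ℝ × ℝ, ℂ)) : ∃ C, ∀ x : ℝ, |x| * ‖oscIntegral p q φ x‖ ≤ C := by
  obtain ⟨C, hC⟩ := exists_norm_oscIntegral_le hq.isBoundedWeight hp (partialFst (swapSchwartz φ))
  obtain ⟨D, hD⟩ := exists_norm_oscIntegral_le hq.isBoundedWeight_deriv hp (swapSchwartz φ)
  refine ⟨C + D, fun x => ?_⟩
  have h := mul_oscIntegral_fst hq hp (swapSchwartz φ) (-x)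
  rw [← oscIntegral_swap] at h
  have h' := congrArg norm h
  rw [norm_mul, norm_mul, Complex.norm_I, one_mul, Complex.norm_real, Real.norm_eq_abs,
    abs_neg] at h'
  rw [h']
  refine (norm_sub_le _ _).trans ?_
  rw [norm_neg]
  exact add_le_add (hC _) (hD _)

/-- One factor x is absorbed by the ξ-integration, the second by the η-integration. The latter
tolerates the merely bounded `deriv p`, so `p` is never differentiated twice. -/
theorem exists_norm_oscIntegral_le_inv_one_add_sq {p q : ℝ → ℂ} (hp : IsKinkWeight p)
    (hq : IsKinkWeight q) (φ : 𝓢(ℝ × ℝ, ℂ)) :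
    ∃ C, ∀ x : ℝ, ‖oscIntegral p q φ x‖ ≤ C * (1 + x ^ 2)⁻¹ := by
  obtain ⟨A, hA⟩ := exists_norm_oscIntegral_le hp.isBoundedWeight hq.isBoundedWeight φ
  obtain ⟨C, hC⟩ := exists_norm_mul_oscIntegral_snd_le hp.isBoundedWeight hq (partialFst φ)
  obtain ⟨D, hD⟩ := exists_norm_mul_oscIntegral_snd_le hp.isBoundedWeight_deriv hq φ
  refine ⟨A + (C + D), fun x => ?_⟩
  rw [← div_eq_mul_inv, le_div_iff₀ (by positivity)]
  have h := congrArg norm (mul_oscIntegral_fst hp hq.isBoundedWeight φ x)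
  rw [norm_mul, norm_mul, Complex.norm_I, one_mul, Complex.norm_real, Real.norm_eq_abs] at h
  have h2 : |x| * ‖oscIntegral p q φ x‖ ≤
      ‖oscIntegral p q (partialFst φ) x‖ + ‖oscIntegral (deriv p) q φ x‖ := by
    rw [h]
    refine (norm_sub_le _ _).trans ?_
    rw [norm_neg]
  have h3 := mul_le_mul_of_nonneg_left h2 (abs_nonneg x)
  have h4 := hA x
  have h5 := hC x
  have h6 := hD x
  have h7 : x ^ 2 = |x| * |x| := by rw [← sq, sq_abs]
  rw [h7]
  nlinarith

theorem aestronglyMeasurable_oscIntegral {p q : ℝ → ℂ} (hp : IsBoundedWeight p) (hq : IsBoundedWeight q)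
    (φ : 𝓢(ℝ × ℝ, ℂ)) : AEStronglyMeasurable (oscIntegral p q φ) := by
  have hp' := hp.1
  have hq' := hq.1
  have hφ := φ.continuous.measurable
  refine StronglyMeasurable.aestronglyMeasurable ?_
  refine StronglyMeasurable.integral_prod_right
    (f := fun (x : ℝ) (z : ℝ × ℝ) => φ z * oscKernel p q x z) ?_
  refine Measurable.stronglyMeasurable ?_
  unfold Function.uncurry oscKernel
  fun_prop

theorem integrable_oscIntegral {p q : ℝ → ℂ} (hp : IsKinkWeight p) (hq : IsKinkWeight q)
    (φ : 𝓢(ℝ × ℝ, ℂ)) : Integrable (oscIntegral p q φ) := by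
  obtain ⟨C, hC⟩ := exists_norm_oscIntegral_le_inv_one_add_sq hp hq φ
  exact (integrable_inv_one_add_sq.const_mul C).mono'
    (aestronglyMeasurable_oscIntegral hp.isBoundedWeight hq.isBoundedWeight φ) (Eventually.of_forall hC)

theorem tendsto_oscIntegral {p q : ℝ → ℂ} (hp : IsKinkWeight p) (hq : IsKinkWeight q)
    (φ : 𝓢(ℝ × ℝ, ℂ)) : Tendsto (oscIntegral p q φ) (cocompact ℝ) (𝓝 0) := by
  obtain ⟨C, hC⟩ := exists_norm_oscIntegral_le_inv_one_add_sq hp hq φ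
  refine squeeze_zero_norm hC ?_
  rw [← mul_zero C]
  refine Tendsto.const_mul C (tendsto_inv_atTop_zero.comp ?_)
  refine tendsto_atTop_add_const_left _ _ ?_
  have := (tendsto_pow_atTop (two_ne_zero)).comp (tendsto_norm_cocompact_atTop (E := ℝ))
  refine this.congr fun x => ?_
  simp

/-! ### Differentiation in x -/

theorem hasTemperateGrowth_fst : Function.HasTemperateGrowth (fun z : ℝ × ℝ => (z.1 : ℂ)) :=
  (Complex.ofRealCLM.comp (ContinuousLinearMap.fst ℝ ℝ ℝ)).hasTemperateGrowth

theorem hasTemperateGrowth_snd : Function.HasTemperateGrowth (fun z : ℝ × ℝ => (z.2 : ℂ)) :=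
  (Complex.ofRealCLM.comp (ContinuousLinearMap.snd ℝ ℝ ℝ)).hasTemperateGrowth

/-- Multiplication of a Schwartz function on the plane by `i (ξ - η)`. -/
def mulFreqDiff (φ : 𝓢(ℝ × ℝ, ℂ)) : 𝓢(ℝ × ℝ, ℂ) :=
  SchwartzMap.smulLeftCLM ℂ (fun z : ℝ × ℝ => Complex.I * ((z.1 : ℂ) - z.2)) φ

theorem mulFreqDiff_apply (φ : 𝓢(ℝ × ℝ, ℂ)) (z : ℝ × ℝ) :
    mulFreqDiff φ z = Complex.I * ((z.1 : ℂ) - z.2) * φ z := by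
  have h1 := hasTemperateGrowth_fst
  have h2 := hasTemperateGrowth_snd
  rw [mulFreqDiff, SchwartzMap.smulLeftCLM_apply_apply (by fun_prop), smul_eq_mul]

theorem hasDerivAt_oscKernel (p q : ℝ → ℂ) (z : ℝ × ℝ) (x : ℝ) :
    HasDerivAt (fun x => oscKernel p q x z)
      (Complex.I * ((z.1 : ℂ) - z.2) * oscKernel p q x z) x := by
  have h1 : HasDerivAt (fun x : ℝ => Complex.exp (Complex.I * x * z.1))
      (Complex.exp (Complex.I * x * z.1) * (Complex.I * 1 * z.1)) x :=
    (((Complex.ofRealCLM.hasDerivAt (x := x)).const_mul Complex.I).mul_const (z.1 : ℂ)).cexp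
  have h2 : HasDerivAt (fun x : ℝ => Complex.exp (Complex.I * (-x : ℝ) * z.2))
      (Complex.exp (Complex.I * (-x : ℝ) * z.2) * (Complex.I * (-1) * z.2)) x := by
    have := (((Complex.ofRealCLM.hasDerivAt (x := x)).neg.const_mul Complex.I).mul_const
      (z.2 : ℂ)).cexp
    simpa using this
  convert! (h1.const_mul (p z.1)).mul (h2.const_mul (q z.2)) using 1
  simp only [oscKernel]
  ring

theorem norm_oscKernel_le {p q : ℝ → ℂ} {C D : ℝ} (hC : ∀ t, ‖p t‖ ≤ C) (hD : ∀ t, ‖q t‖ ≤ D)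
    (x : ℝ) (z : ℝ × ℝ) : ‖oscKernel p q x z‖ ≤ C * D := by
  rw [oscKernel, norm_mul, norm_mul, norm_mul, norm_exp_I_mul_mul, norm_exp_I_mul_mul,
    mul_one, mul_one]
  exact mul_le_mul (hC _) (hD _) (norm_nonneg _) ((norm_nonneg _).trans (hC 0))

theorem hasDerivAt_oscIntegral {p q : ℝ → ℂ} (hp : IsBoundedWeight p) (hq : IsBoundedWeight q)
    (φ : 𝓢(ℝ × ℝ, ℂ)) (x : ℝ) :
    HasDerivAt (oscIntegral p q φ) (oscIntegral p q (mulFreqDiff φ) x) x := by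
  obtain ⟨C, hC⟩ := hp.2
  obtain ⟨D, hD⟩ := hq.2
  refine (hasDerivAt_integral_of_dominated_loc_of_deriv_le (μ := volume) (s := Set.univ)
    (F := fun x z => φ z * oscKernel p q x z)
    (F' := fun x z => mulFreqDiff φ z * oscKernel p q x z)
    (bound := fun z => ‖mulFreqDiff φ z‖ * (C * D)) univ_mem
    (Eventually.of_forall fun y => (integrable_mul_oscKernel hp hq y φ).aestronglyMeasurable)
    (integrable_mul_oscKernel hp hq x φ)
    (integrable_mul_oscKernel hp hq x _).aestronglyMeasurable
    (Eventually.of_forall fun z y _ => ?_) ((mulFreqDiff φ).integrable.norm.mul_const _)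
    (Eventually.of_forall fun z y _ => ?_)).2
  · rw [norm_mul]
    gcongr
    exact norm_oscKernel_le hC hD y z
  · convert! (hasDerivAt_oscKernel p q z y).const_mul (φ z) using 1
    rw [mulFreqDiff_apply]
    ring

/-! ### Fourier inversion on the diagonal -/

/-- The integral of `φ(ξ, η) p(ξ) q(η)` along the line `ξ - η = t`. -/
def diagonalIntegral (p q : ℝ → ℂ) (φ : 𝓢(ℝ × ℝ, ℂ)) (t : ℝ) : ℂ :=
  ∫ s, φ (t + s, s) * (p (t + s) * q s)

theorem continuous_diagonalIntegral {p q : ℝ → ℂ} (hp : IsKinkWeight p) (hq : IsKinkWeight q)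
    (φ : 𝓢(ℝ × ℝ, ℂ)) : Continuous (diagonalIntegral p q φ) := by
  obtain ⟨C, hC⟩ := hp.bounded
  obtain ⟨D, hD⟩ := hq.bounded
  have hpc := hp.continuous
  have hqc := hq.continuous
  have hφ := φ.continuous
  -- The sup norm of (t + s, s) is at least |s|, so decay of orders 0 and 2 gives a majorant
  -- independent of t.
  obtain ⟨A, hA⟩ := φ.decay 0 0
  obtain ⟨B, hB⟩ := φ.decay 2 0
  have hdecay : ∀ t s : ℝ, ‖φ (t + s, s)‖ ≤ (A + B) * (1 + s ^ 2)⁻¹ := fun t s => by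
    have h1 := hA.2 (t + s, s)
    have h2 := hB.2 (t + s, s)
    simp only [norm_iteratedFDeriv_zero, pow_zero, one_mul] at h1 h2
    have h3 : s ^ 2 ≤ ‖(t + s, s)‖ ^ 2 := by
      rw [← sq_abs s]
      exact pow_le_pow_left₀ (abs_nonneg _) (le_max_right _ _) 2
    rw [← div_eq_mul_inv, le_div_iff₀ (by positivity)]
    have h4 := mul_le_mul_of_nonneg_right h3 (norm_nonneg (φ (t + s, s)))
    linarith
  refine continuous_of_dominated (bound := fun s => (A + B) * (1 + s ^ 2)⁻¹ * (C * D))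
    (fun t => Continuous.aestronglyMeasurable (by fun_prop))
    (fun t => Eventually.of_forall fun s => ?_)
    ((integrable_inv_one_add_sq.const_mul _).mul_const _)
    (Eventually.of_forall fun s => by fun_prop)
  rw [norm_mul, norm_mul]
  have := (norm_nonneg _).trans (hdecay t s)
  have := (norm_nonneg _).trans (hC 0)
  gcongr
  · exact hdecay t s
  · exact hC _
  · exact hD _

theorem integrable_shear {f : ℝ × ℝ → ℂ} (hf : Integrable f) :
    Integrable (fun z : ℝ × ℝ => f (z.1 + z.2, z.2)) :=
  (measurePreserving_add_prod volume volume).integrable_comp_of_integrable hf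

theorem integral_shear {f : ℝ × ℝ → ℂ} (hf : Integrable f) :
    ∫ z, f z = ∫ t, ∫ s, f (t + s, s) := by
  have hmp := measurePreserving_add_prod (volume : Measure ℝ) (volume : Measure ℝ)
  have h2 := integrable_shear hf
  rw [Measure.volume_eq_prod] at h2 hf ⊢
  rw [← integral_prod _ h2]
  conv_lhs => rw [← hmp.map_eq]
  rw [integral_map hmp.aemeasurable (by rw [hmp.map_eq]; exact hf.aestronglyMeasurable)]

theorem integrable_diagonalIntegral {p q : ℝ → ℂ} (hp : IsBoundedWeight p)
    (hq : IsBoundedWeight q) (φ : 𝓢(ℝ × ℝ, ℂ)) : Integrable (diagonalIntegral p q φ) := by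
  -- At x = 0 the kernel is just p(ξ) q(η).
  have h := integrable_shear (integrable_mul_oscKernel hp hq 0 φ)
  rw [Measure.volume_eq_prod] at h
  refine h.integral_prod_left.congr (Eventually.of_forall fun t => ?_)
  simp [oscKernel, diagonalIntegral]

/-- The phase depends only on t = ξ - η, so integrating along the lines ξ - η = t first leaves a
one-dimensional transform. The scaling converts e^{ixt} to the convention e^{-2πitv}. -/
theorem oscIntegral_eq_fourier {p q : ℝ → ℂ} (hp : IsBoundedWeight p)
    (hq : IsBoundedWeight q) (φ : 𝓢(ℝ × ℝ, ℂ)) (x : ℝ) :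
    oscIntegral p q φ x =
      FourierTransform.fourier (diagonalIntegral p q φ) (-(2 * Real.pi)⁻¹ * x) := by
  rw [oscIntegral, integral_shear (integrable_mul_oscKernel hp hq x φ),
    Real.fourier_real_eq_integral_exp_smul]
  refine integral_congr_ae (Eventually.of_forall fun t => ?_)
  simp only
  rw [diagonalIntegral, smul_eq_mul, ← integral_const_mul]
  refine integral_congr_ae (Eventually.of_forall fun s => ?_)
  simp only [oscKernel]
  have h : Complex.exp (↑(-2 * Real.pi * t * (-(2 * Real.pi)⁻¹ * x)) * Complex.I) =
      Complex.exp (Complex.I * x * (t + s : ℝ)) * Complex.exp (Complex.I * (-x : ℝ) * s) := by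
    rw [← Complex.exp_add]
    congr 1
    have : -2 * Real.pi * t * (-(2 * Real.pi)⁻¹ * x) = t * x := by
      field_simp
    rw [this]
    push_cast
    ring
  rw [h]
  ring

/-- Fourier inversion at the point 0; the factor 2π is the Jacobian of the rescaling of x. -/
theorem integral_oscIntegral {p q : ℝ → ℂ} (hp : IsKinkWeight p) (hq : IsKinkWeight q)
    (φ : 𝓢(ℝ × ℝ, ℂ)) :
    ∫ x, oscIntegral p q φ x = 2 * Real.pi * ∫ s, φ (s, s) * (p s * q s) := by
  have hfun : oscIntegral p q φ = fun x => FourierTransform.fourier (diagonalIntegral p q φ)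
      (-(2 * Real.pi)⁻¹ * x) :=
    funext (oscIntegral_eq_fourier hp.isBoundedWeight hq.isBoundedWeight φ)
  have hc : -(2 * Real.pi)⁻¹ ≠ 0 := by
    have := Real.pi_pos
    exact neg_ne_zero.2 (by positivity)
  have hint : Integrable (FourierTransform.fourier (diagonalIntegral p q φ)) := by
    have h := integrable_oscIntegral hp hq φ
    rw [hfun] at h
    exact (integrable_comp_mul_left_iff _ hc).1 h
  have hinv := (integrable_diagonalIntegral hp.isBoundedWeight hq.isBoundedWeight
    φ).fourierInv_fourier_eq hint (v := 0) (continuous_diagonalIntegral hp hq φ).continuousAt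
  rw [Real.fourierInv_eq'] at hinv
  simp only [inner_zero_right, mul_zero, Complex.ofReal_zero, zero_mul, Complex.exp_zero,
    one_smul] at hinv
  rw [hfun, Measure.integral_comp_mul_left, hinv]
  simp [diagonalIntegral, abs_of_pos Real.pi_pos]

/-! ### The weight of the distorted basis -/

/-- The weight `1 / (|ξ| - i a)²`. -/
def resolventWeight (a t : ℝ) : ℂ := (((|t| : ℝ) - Complex.I * a) ^ 2)⁻¹

theorem abs_le_norm_abs_sub_I_mul (a t : ℝ) : |a| ≤ ‖((|t| : ℝ) : ℂ) - Complex.I * a‖ := by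
  have h := Complex.abs_im_le_norm (((|t| : ℝ) : ℂ) - Complex.I * a)
  simpa using h

theorem abs_sub_I_mul_ne_zero {a : ℝ} (ha : a ≠ 0) (t : ℝ) :
    ((|t| : ℝ) : ℂ) - Complex.I * a ≠ 0 :=
  norm_pos_iff.1 ((abs_pos.2 ha).trans_le (abs_le_norm_abs_sub_I_mul a t))

theorem hasDerivAt_resolventWeight {a t : ℝ} (ha : a ≠ 0) (ht : t ≠ 0) :
    HasDerivAt (resolventWeight a) (-(2 * ((|t| : ℝ) - Complex.I * a) * (SignType.sign t : ℝ)) /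
      (((|t| : ℝ) - Complex.I * a) ^ 2) ^ 2) t := by
  have h : HasDerivAt (fun t : ℝ => ((|t| : ℝ) : ℂ) - Complex.I * a)
      ((SignType.sign t : ℝ) : ℂ) t := ((hasDerivAt_abs ht).ofReal_comp).sub_const _
  convert! (h.pow 2).inv (pow_ne_zero 2 (abs_sub_I_mul_ne_zero ha t)) using 1
  simp

theorem isKinkWeight_resolventWeight {a : ℝ} (ha : a ≠ 0) : IsKinkWeight (resolventWeight a) := by
  have ha' : 0 < |a| := abs_pos.2 ha
  refine ⟨?_, ⟨(|a| ^ 2)⁻¹, fun t => ?_⟩, fun t ht =>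
    (hasDerivAt_resolventWeight ha ht).differentiableAt,
    -- The value of `deriv` at the kink is a single number, so it goes into the bound without being
    -- computed.
    ⟨max ‖deriv (resolventWeight a) 0‖ (2 / |a| ^ 3), fun t => ?_⟩⟩
  · exact Continuous.inv₀ (by fun_prop) fun t => pow_ne_zero 2 (abs_sub_I_mul_ne_zero ha t)
  · rw [resolventWeight, norm_inv, norm_pow]
    gcongr
    exact abs_le_norm_abs_sub_I_mul a t
  · rcases eq_or_ne t 0 with rfl | ht
    · exact le_max_left _ _
    · refine le_max_of_le_right ?_
      have hn := abs_le_norm_abs_sub_I_mul a t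
      have hpos := ha'.trans_le hn
      have hs : ‖(((SignType.sign t : ℝ)) : ℂ)‖ ≤ 1 := by
        rcases lt_or_gt_of_ne ht with h | h <;> simp [h]
      rw [(hasDerivAt_resolventWeight ha ht).deriv, norm_div, norm_neg, norm_mul, norm_mul,
        norm_pow, norm_pow, RCLike.norm_ofNat]
      set N := ‖((|t| : ℝ) : ℂ) - Complex.I * a‖
      calc 2 * N * ‖(((SignType.sign t : ℝ)) : ℂ)‖ / (N ^ 2) ^ 2 ≤ 2 * N * 1 / (N ^ 2) ^ 2 := by
            gcongr
        _ = 2 / N ^ 3 := by field_simp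
        _ ≤ 2 / |a| ^ 3 := by gcongr

theorem resolventWeight_mul_neg {a : ℝ} (t : ℝ) :
    resolventWeight a t * resolventWeight (-a) t = (((t : ℂ) ^ 2 + (a : ℂ) ^ 2) ^ 2)⁻¹ := by
  rw [resolventWeight, resolventWeight, ← mul_inv, ← mul_pow]
  have h : ((|t| : ℝ) : ℂ) ^ 2 = (t : ℂ) ^ 2 := by rw [← Complex.ofReal_pow, sq_abs]; simp
  congr 2
  push_cast
  linear_combination h - (a : ℂ) ^ 2 * Complex.I_sq

theorem star_resolventWeight (a t : ℝ) :
    star (resolventWeight a t) = resolventWeight (-a) t := by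
  simp [resolventWeight, ← starRingEnd_apply]

theorem star_exp_I_mul_mul (x t : ℝ) :
    star (Complex.exp (Complex.I * x * t)) = Complex.exp (Complex.I * (-x : ℝ) * t) := by
  rw [← starRingEnd_apply, ← Complex.exp_conj]
  simp

theorem oscIntegral_add {p q : ℝ → ℂ} (hp : IsBoundedWeight p) (hq : IsBoundedWeight q)
    (φ ψ : 𝓢(ℝ × ℝ, ℂ)) (x : ℝ) :
    oscIntegral p q (φ + ψ) x = oscIntegral p q φ x + oscIntegral p q ψ x := by
  rw [oscIntegral, oscIntegral, oscIntegral,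
    ← integral_add (integrable_mul_oscKernel hp hq x φ) (integrable_mul_oscKernel hp hq x ψ)]
  simp [add_mul]

theorem oscIntegral_smul (p q : ℝ → ℂ) (c : ℂ) (φ : 𝓢(ℝ × ℝ, ℂ)) (x : ℝ) :
    oscIntegral p q (c • φ) x = c * oscIntegral p q φ x := by
  rw [oscIntegral, oscIntegral, ← integral_const_mul]
  simp [mul_assoc]

theorem hasDerivAt_tanh_mul (a x : ℝ) :
    HasDerivAt (fun x => Real.tanh (a * x)) (a * (1 - Real.tanh (a * x) ^ 2)) x := by
  have hc := (Real.cosh_pos (a * x)).ne'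
  have h : HasDerivAt (fun x => a * x) a x := by simpa using (hasDerivAt_id x).const_mul a
  have := h.sinh.div h.cosh hc
  simp only [Real.tanh_eq_sinh_div_cosh]
  convert! this using 1
  field_simp

theorem sech_sq (x : ℝ) : sech x ^ 2 = 1 - Real.tanh x ^ 2 := by
  have hc := (Real.cosh_pos x).ne'
  rw [sech, Real.tanh_eq_sinh_div_cosh]
  field_simp
  linear_combination -Real.cosh_sq x

/-! ### Total derivatives in x -/

/-- The derivative of `x ↦ tanh(a x)ⁿ H(x)`, where `H` is the oscillatory integral of `φ`. -/
def tanhPowDeriv (p q : ℝ → ℂ) (a : ℝ) (n : ℕ) (φ : 𝓢(ℝ × ℝ, ℂ)) (x : ℝ) : ℂ :=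
  ((n * Real.tanh (a * x) ^ (n - 1) * (a * (1 - Real.tanh (a * x) ^ 2)) : ℝ) : ℂ) *
    oscIntegral p q φ x +
  ((Real.tanh (a * x) ^ n : ℝ) : ℂ) * oscIntegral p q (mulFreqDiff φ) x

theorem integrable_tanhPowDeriv {p q : ℝ → ℂ} (hp : IsKinkWeight p) (hq : IsKinkWeight q)
    (a : ℝ) (n : ℕ) (φ : 𝓢(ℝ × ℝ, ℂ)) : Integrable (tanhPowDeriv p q a n φ) := by
  have hT : Continuous fun x => Real.tanh (a * x) :=
    continuous_iff_continuousAt.2 fun x => (hasDerivAt_tanh_mul a x).continuousAt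
  have hb : ∀ (m : ℕ) x, |Real.tanh (a * x) ^ m| ≤ 1 := fun m x => by
    rw [abs_pow]
    exact pow_le_one₀ (abs_nonneg _) (Real.abs_tanh_lt_one _).le
  refine Integrable.add ?_ ?_
  · refine (integrable_oscIntegral hp hq φ).bdd_mul (c := n * 1 * (|a| * 1))
      (Continuous.aestronglyMeasurable (by fun_prop)) (Eventually.of_forall fun x => ?_)
    rw [Complex.norm_real, Real.norm_eq_abs, abs_mul, abs_mul, abs_mul, Nat.abs_cast]
    gcongr
    · exact hb _ x
    · rw [abs_le]
      constructor <;> nlinarith [Real.tanh_sq_lt_one (a * x), sq_nonneg (Real.tanh (a * x))]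
  · refine (integrable_oscIntegral hp hq _).bdd_mul (c := 1)
      (Continuous.aestronglyMeasurable (by fun_prop)) (Eventually.of_forall fun x => ?_)
    rw [Complex.norm_real, Real.norm_eq_abs]
    exact hb _ x

/-- The primitive tanhⁿ H tends to 0 at both ends, since tanh is bounded and H decays. -/
theorem integral_tanhPowDeriv {p q : ℝ → ℂ} (hp : IsKinkWeight p) (hq : IsKinkWeight q)
    (a : ℝ) (n : ℕ) (φ : 𝓢(ℝ × ℝ, ℂ)) : ∫ x, tanhPowDeriv p q a n φ x = 0 := by
  have hlim : Tendsto (fun x => ((Real.tanh (a * x) ^ n : ℝ) : ℂ) * oscIntegral p q φ x)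
      (cocompact ℝ) (𝓝 0) := by
    refine squeeze_zero_norm (fun x => ?_) (tendsto_zero_iff_norm_tendsto_zero.1
      (tendsto_oscIntegral hp hq φ))
    rw [norm_mul, Complex.norm_real, Real.norm_eq_abs, abs_pow]
    exact mul_le_of_le_one_left (norm_nonneg _)
      (pow_le_one₀ (abs_nonneg _) (Real.abs_tanh_lt_one _).le)
  rw [cocompact_eq_atBot_atTop, tendsto_sup] at hlim
  rw [integral_of_hasDerivAt_of_tendsto (fun x => ?_) (integrable_tanhPowDeriv hp hq a n φ)
    hlim.1 hlim.2, sub_zero]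
  exact ((hasDerivAt_tanh_mul a x).pow n).ofReal_comp.mul
    (hasDerivAt_oscIntegral hp.isBoundedWeight hq.isBoundedWeight φ x)

/-! ### The densities as polynomials times the kernel -/

theorem psi1_eq (ω x ξ : ℝ) :
    psi1 ω x ξ = 1 / (√(2 * Real.pi) : ℂ) *
      ((ξ : ℂ) + Complex.I * √ω * Real.tanh (√ω * x)) ^ 2 *
      (resolventWeight √ω ξ * Complex.exp (Complex.I * x * ξ)) := by
  rw [psi1, resolventWeight]
  ring

theorem psi2_eq (ω x ξ : ℝ) :
    psi2 ω x ξ = 1 / (√(2 * Real.pi) : ℂ) * ((√ω : ℂ) * sech (√ω * x)) ^ 2 *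
      (resolventWeight √ω ξ * Complex.exp (Complex.I * x * ξ)) := by
  rw [psi2, resolventWeight]
  ring

theorem star_psi1 (ω x ξ : ℝ) :
    star (psi1 ω x ξ) = 1 / (√(2 * Real.pi) : ℂ) *
      ((ξ : ℂ) - Complex.I * √ω * Real.tanh (√ω * x)) ^ 2 *
      (resolventWeight (-√ω) ξ * Complex.exp (Complex.I * (-x : ℝ) * ξ)) := by
  rw [psi1_eq, star_mul', star_mul', star_mul', star_resolventWeight, star_exp_I_mul_mul]
  simp [← starRingEnd_apply, -Complex.ofReal_tanh, ← sub_eq_add_neg]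

theorem star_psi2 (ω x ξ : ℝ) :
    star (psi2 ω x ξ) = 1 / (√(2 * Real.pi) : ℂ) * ((√ω : ℂ) * sech (√ω * x)) ^ 2 *
      (resolventWeight (-√ω) ξ * Complex.exp (Complex.I * (-x : ℝ) * ξ)) := by
  rw [psi2_eq, star_mul', star_mul', star_mul', star_resolventWeight, star_exp_I_mul_mul]
  simp [← starRingEnd_apply]

theorem inv_sqrt_two_pi_sq : (1 / (√(2 * Real.pi) : ℂ)) ^ 2 = (2 * Real.pi : ℂ)⁻¹ := by
  rw [div_pow, ← Complex.ofReal_pow, Real.sq_sqrt (by positivity)]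
  simp

theorem sech_sq_ofReal (x : ℝ) : (sech x : ℂ) ^ 2 = 1 - (Real.tanh x : ℂ) ^ 2 := by
  exact_mod_cast congrArg (fun y : ℝ => (y : ℂ)) (sech_sq x)

theorem innerDensity_plus_plus (ω x : ℝ) (z : ℝ × ℝ) :
    innerDensity (psiPlus ω x z.1) (pauli3 *ᵥ psiPlus ω x z.2) = (2 * Real.pi : ℂ)⁻¹ *
      (((z.1 + Complex.I * √ω * Real.tanh (√ω * x)) *
        (z.2 - Complex.I * √ω * Real.tanh (√ω * x))) ^ 2 -
        ((√ω : ℂ) ^ 2 * (1 - (Real.tanh (√ω * x) : ℂ) ^ 2)) ^ 2) *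
      oscKernel (resolventWeight √ω) (resolventWeight (-√ω)) x z := by
  have h : innerDensity (psiPlus ω x z.1) (pauli3 *ᵥ psiPlus ω x z.2) =
      psi1 ω x z.1 * star (psi1 ω x z.2) - psi2 ω x z.1 * star (psi2 ω x z.2) := by
    simp [innerDensity, psiPlus, pauli3, Matrix.mulVec, dotProduct, sub_eq_add_neg]
  rw [h, star_psi1, star_psi2, psi1_eq, psi2_eq, ← sech_sq_ofReal, ← inv_sqrt_two_pi_sq, oscKernel]
  ring

theorem innerDensity_plus_minus (ω x : ℝ) (z : ℝ × ℝ) :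
    innerDensity (psiPlus ω x z.1) (pauli3 *ᵥ psiMinus ω x z.2) = (2 * Real.pi : ℂ)⁻¹ *
      ((√ω : ℂ) ^ 2 * (1 - (Real.tanh (√ω * x) : ℂ) ^ 2) *
        ((z.1 + Complex.I * √ω * Real.tanh (√ω * x)) ^ 2 -
        (z.2 - Complex.I * √ω * Real.tanh (√ω * x)) ^ 2)) *
      oscKernel (resolventWeight √ω) (resolventWeight (-√ω)) x z := by
  have h : innerDensity (psiPlus ω x z.1) (pauli3 *ᵥ psiMinus ω x z.2) =
      psi1 ω x z.1 * star (psi2 ω x z.2) - psi2 ω x z.1 * star (psi1 ω x z.2) := by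
    simp [innerDensity, psiPlus, psiMinus, pauli3, pauli1, Matrix.mulVec, dotProduct,
      sub_eq_add_neg]
  rw [h, star_psi1, star_psi2, psi1_eq, psi2_eq, ← sech_sq_ofReal, ← inv_sqrt_two_pi_sq, oscKernel]
  ring

theorem PairingEqDistribution.neg {U V U' V' : ℝ → ℝ → Fin 2 → ℂ} {T : 𝓢'(ℝ × ℝ, ℂ)}
    (h : PairingEqDistribution U V T)
    (hneg : ∀ x ξ η, innerDensity (U' x ξ) (V' x η) = -innerDensity (U x ξ) (V x η)) :
    PairingEqDistribution U' V' (-T) := by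
  intro φ
  obtain ⟨h1, h2, h3⟩ := h φ
  simp only [hneg, mul_neg, integral_neg]
  refine ⟨fun x => (h1 x).neg, h2.neg, ?_⟩
  rw [h3]
  rfl

/-- A pairing whose density is, against a test function, an oscillatory kernel times a
combination of Schwartz functions depending on `x`. -/
theorem pairingEqDistribution_of_oscKernel {p q : ℝ → ℂ} (hp : IsBoundedWeight p)
    (hq : IsBoundedWeight q) {U V : ℝ → ℝ → Fin 2 → ℂ} {T : 𝓢'(ℝ × ℝ, ℂ)}
    (h : ∀ φ : 𝓢(ℝ × ℝ, ℂ), ∃ ψ : ℝ → 𝓢(ℝ × ℝ, ℂ),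
      (∀ x z, φ z * innerDensity (U x z.1) (V x z.2) = ψ x z * oscKernel p q x z) ∧
      Integrable (fun x => oscIntegral p q (ψ x) x) ∧
      ∫ x, oscIntegral p q (ψ x) x = T φ) :
    PairingEqDistribution U V T := by
  intro φ
  obtain ⟨ψ, h1, h2, h3⟩ := h φ
  simp only [h1]
  exact ⟨fun x => integrable_mul_oscKernel hp hq x (ψ x), h2, h3⟩

/-! ### The four pairings -/

theorem pairing_plus_plus {ω : ℝ} (hω : 0 < ω) :
    PairingEqDistribution (psiPlus ω) (fun x η => pauli3 *ᵥ psiPlus ω x η) deltaDiag := by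
  have ha : √ω ≠ 0 := (Real.sqrt_pos.2 hω).ne'
  have hp := isKinkWeight_resolventWeight ha
  have hq := isKinkWeight_resolventWeight (neg_ne_zero.2 ha)
  have ht1 := hasTemperateGrowth_fst
  have ht2 := hasTemperateGrowth_snd
  refine pairingEqDistribution_of_oscKernel hp.isBoundedWeight hq.isBoundedWeight fun φ => ?_
  set a := √ω with ha_def
  -- `φ₀` carries the τ-free part P², while `α` and `β` are the coefficients of τ and τ² in the
  -- primitive.
  set φ₀ : 𝓢(ℝ × ℝ, ℂ) :=
    SchwartzMap.smulLeftCLM ℂ (fun z : ℝ × ℝ => ((z.1 : ℂ) * z.2 + (a : ℂ) ^ 2) *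
      ((z.1 : ℂ) * z.2 + (a : ℂ) ^ 2)) φ with hφ₀
  set α : 𝓢(ℝ × ℝ, ℂ) := SchwartzMap.smulLeftCLM ℂ
    (fun z : ℝ × ℝ => (-2 * a : ℂ) * ((z.1 : ℂ) * z.2 + (a : ℂ) ^ 2)) φ with hα
  set β : 𝓢(ℝ × ℝ, ℂ) := SchwartzMap.smulLeftCLM ℂ
    (fun z : ℝ × ℝ => (Complex.I * (a : ℂ) ^ 2) * ((z.1 : ℂ) - z.2)) φ with hβ
  have e₀ : ∀ z, φ₀ z = ((z.1 : ℂ) * z.2 + (a : ℂ) ^ 2) ^ 2 * φ z := fun z => by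
    rw [hφ₀, SchwartzMap.smulLeftCLM_apply_apply (by fun_prop), smul_eq_mul]
    ring
  have eα : ∀ z, α z = (-2 * a : ℂ) * ((z.1 : ℂ) * z.2 + (a : ℂ) ^ 2) * φ z := fun z => by
    rw [hα, SchwartzMap.smulLeftCLM_apply_apply (by fun_prop), smul_eq_mul]
  have eβ : ∀ z, β z = (Complex.I * (a : ℂ) ^ 2) * ((z.1 : ℂ) - z.2) * φ z := fun z => by
    rw [hβ, SchwartzMap.smulLeftCLM_apply_apply (by fun_prop), smul_eq_mul]
  clear_value φ₀ α β
  set p := resolventWeight a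
  set q := resolventWeight (-a)
  let τ : ℝ → ℂ := fun x => (Real.tanh (a * x) : ℂ)
  -- The product rule: for each power of τ, either τ is differentiated or the exponential is, the
  -- latter producing `mulFreqDiff`.
  let ψ : ℝ → 𝓢(ℝ × ℝ, ℂ) := fun x => (2 * Real.pi : ℂ)⁻¹ • (φ₀ +
    (((a * (1 - τ x ^ 2)) • α + τ x • mulFreqDiff α) +
    ((2 * τ x * (a * (1 - τ x ^ 2))) • β + τ x ^ 2 • mulFreqDiff β)))
  have hψ : (fun x => oscIntegral p q (ψ x) x) = fun x => (2 * Real.pi : ℂ)⁻¹ *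
      (oscIntegral p q φ₀ x + (tanhPowDeriv p q a 1 α x + tanhPowDeriv p q a 2 β x)) := by
    funext x
    simp only [ψ, oscIntegral_smul, oscIntegral_add hp.isBoundedWeight hq.isBoundedWeight,
      tanhPowDeriv, τ]
    push_cast
    ring
  have i₀ := integrable_oscIntegral hp hq φ₀
  have i₁ := integrable_tanhPowDeriv hp hq a 1 α
  have i₂ := integrable_tanhPowDeriv hp hq a 2 β
  refine ⟨ψ, fun x z => ?_, ?_, ?_⟩
  · rw [innerDensity_plus_plus]
    simp only [ψ, smul_apply, add_apply, smul_eq_mul, mulFreqDiff_apply,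
      e₀, eα, eβ, ← ha_def]
    -- The identity holds only modulo i² = -1; the coefficient is the quotient by i² + 1.
    linear_combination (φ z * (Real.pi : ℂ)⁻¹ * oscKernel p q x z *
      (z.1 * Complex.I * a ^ 3 * Real.tanh (a * x) ^ 3 -
        z.1 * z.2 * a ^ 2 * Real.tanh (a * x) ^ 2 -
        Complex.I * a ^ 3 * Real.tanh (a * x) ^ 3 * z.2 +
        a ^ 4 * Real.tanh (a * x) ^ 4 * (Complex.I ^ 2 - 1) / 2)) * Complex.I_sq
  · rw [hψ]
    exact (i₀.add (i₁.add i₂)).const_mul _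
  · rw [hψ, integral_const_mul, integral_add i₀ (by exact i₁.add i₂), integral_add i₁ i₂,
      integral_tanhPowDeriv hp hq, integral_tanhPowDeriv hp hq, integral_oscIntegral hp hq,
      deltaDiag_apply, add_zero, add_zero, ← mul_assoc,
      inv_mul_cancel₀ (by simp [Real.pi_ne_zero]), one_mul]
    refine integral_congr_ae (Eventually.of_forall fun s => ?_)
    -- On the diagonal P² = (s² + a²)² cancels the product of the two weights exactly.
    have hne : (s : ℂ) ^ 2 + (a : ℂ) ^ 2 ≠ 0 := by
      have : 0 < s ^ 2 + a ^ 2 := by positivity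
      exact_mod_cast this.ne'
    simp only [p, q, e₀, resolventWeight_mul_neg]
    field_simp

theorem pairing_plus_minus {ω : ℝ} (hω : 0 < ω) :
    PairingEqDistribution (psiPlus ω) (fun x η => pauli3 *ᵥ psiMinus ω x η) 0 := by
  have ha : √ω ≠ 0 := (Real.sqrt_pos.2 hω).ne'
  have hp := isKinkWeight_resolventWeight ha
  have hq := isKinkWeight_resolventWeight (neg_ne_zero.2 ha)
  have ht1 := hasTemperateGrowth_fst
  have ht2 := hasTemperateGrowth_snd
  refine pairingEqDistribution_of_oscKernel hp.isBoundedWeight hq.isBoundedWeight fun φ => ?_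
  set a := √ω with ha_def
  set γ : 𝓢(ℝ × ℝ, ℂ) := SchwartzMap.smulLeftCLM ℂ
    (fun z : ℝ × ℝ => (-Complex.I * (a : ℂ) ^ 2) * ((z.1 : ℂ) + z.2)) φ with hγ
  have eγ : ∀ z, γ z = (-Complex.I * (a : ℂ) ^ 2) * ((z.1 : ℂ) + z.2) * φ z := fun z => by
    rw [hγ, SchwartzMap.smulLeftCLM_apply_apply (by fun_prop), smul_eq_mul]
  clear_value γ
  set p := resolventWeight a
  set q := resolventWeight (-a)
  let τ : ℝ → ℂ := fun x => (Real.tanh (a * x) : ℂ)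
  let ψ : ℝ → 𝓢(ℝ × ℝ, ℂ) := fun x => (2 * Real.pi : ℂ)⁻¹ •
    ((-(2 * τ x * (a * (1 - τ x ^ 2)))) • γ + (1 - τ x ^ 2) • mulFreqDiff γ)
  -- The primitive has factor 1 - τ² = τ⁰ - τ². For n = 0 the truncated exponent n - 1 is harmless
  -- because the factor n vanishes.
  have hψ : (fun x => oscIntegral p q (ψ x) x) = fun x => (2 * Real.pi : ℂ)⁻¹ *
      (tanhPowDeriv p q a 0 γ x - tanhPowDeriv p q a 2 γ x) := by
    funext x
    simp only [ψ, oscIntegral_smul, oscIntegral_add hp.isBoundedWeight hq.isBoundedWeight,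
      tanhPowDeriv, τ]
    push_cast
    ring
  have i₁ := integrable_tanhPowDeriv hp hq a 0 γ
  have i₂ := integrable_tanhPowDeriv hp hq a 2 γ
  refine ⟨ψ, fun x z => ?_, ?_, ?_⟩
  · rw [innerDensity_plus_minus]
    simp only [ψ, smul_apply, add_apply, smul_eq_mul, mulFreqDiff_apply,
      eγ, ← ha_def]
    linear_combination (φ z * (Real.pi : ℂ)⁻¹ * oscKernel p q x z *
      (a ^ 2 * (1 - Real.tanh (a * x) ^ 2) * (z.1 ^ 2 - z.2 ^ 2)) / 2) * Complex.I_sq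
  · rw [hψ]
    exact (i₁.sub i₂).const_mul _
  · rw [hψ, integral_const_mul, integral_sub i₁ i₂,
      integral_tanhPowDeriv hp hq, integral_tanhPowDeriv hp hq, sub_zero, mul_zero]
    rfl

theorem lemma3p7 (ω : ℝ) (hω : 0 < ω) :
    PairingEqDistribution (psiPlus ω) (fun x η => pauli3 *ᵥ psiPlus ω x η) deltaDiag ∧
    PairingEqDistribution (psiMinus ω) (fun x η => pauli3 *ᵥ psiMinus ω x η) (-deltaDiag) ∧
    PairingEqDistribution (psiPlus ω) (fun x η => pauli3 *ᵥ psiMinus ω x η) 0 ∧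
    PairingEqDistribution (psiMinus ω) (fun x η => pauli3 *ᵥ psiPlus ω x η) 0 := by
  refine ⟨pairing_plus_plus hω, (pairing_plus_plus hω).neg fun x ξ η => ?_,
    pairing_plus_minus hω, ?_⟩
  -- The sign comes from σ₁σ₃σ₁ = -σ₃, here and in the last pairing.
  · simp [innerDensity, psiPlus, psiMinus, pauli3, pauli1, Matrix.mulVec, dotProduct]
  · rw [← neg_zero]
    refine (pairing_plus_minus hω).neg fun x ξ η => ?_
    simp [innerDensity, psiPlus, psiMinus, pauli3, pauli1, Matrix.mulVec, dotProduct, add_comm]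

end
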